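/- Write points of $\mathbb{H}^n$ as $q=(q_0,\dots,q_{n-1})$ with $q_l=x_{4l}+\mathbf{i}x_{4l+1}+\mathbf{j}x_{4l+2}+\mathbf{k}x_{4l+3}$, and for $0\le l<n$ let $$\begin{pmatrix}\nabla_{(2l)0}&\nabla_{(2l)1}\\ \nabla_{(2l+1)0}&\nabla_{(2l+1)1}\end{pmatrix}=\begin{pmatrix}\partial_{x_{4l}}+\mathbf{i}\partial_{x_{4l+1}}&-\partial_{x_{4l+2}}-\mathbf{i}\partial_{x_{4l+3}}\\ \partial_{x_{4l+2}}-\mathbf{i}\partial_{x_{4l+3}}&\partial_{x_{4l}}-\mathbf{i}\partial_{x_{4l+1}}\end{pmatrix},\qquad \triangle_{ij}u=\tfrac12\left(\nabla_{i0}\nabla_{j1}u-\nabla_{i1}\nabla_{j0}u\right)\quad(0\le i,j<2n).$$ For real-valued $C^2$ functions $f_1,\dots,f_n$ on $\mathbb{H}^n$ put $$\triangle_n(f_1,\dots,f_n)=\sum_{i_1,j_1,\dots,i_n,j_n=0}^{2n-1}\delta^{i_1j_1\dots i_nj_n}_{01\dots(2n-1)}\,\triangle_{i_1j_1}f_1\cdots\triangle_{i_nj_n}f_n,$$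 where $\delta^{i_1j_1\dots i_nj_n}_{01\dots(2n-1)}$ is the sign of the permutation from $(i_1,j_1,\dots,i_n,j_n)$ to $(0,1,\dots,2n-1)$ if it is one and $0$ otherwise, and $$\triangle_n u=\sum_{i_1,j_1,\dots,i_n,j_n=0}^{2n-1}\delta^{i_1j_1\dots i_nj_n}_{01\dots(2n-1)}\,\nabla_{i_10}\nabla_{j_11}u\cdots\nabla_{i_n0}\nabla_{j_n1}u .$$ The quaternionic Hessian of a real-valued $C^2$ function $u$ is the hyperhermitian matrix $H(u)$ with entry $$H(u)_{lk}=\frac{\partial^2u}{\partial\bar q_l\,\partial q_k}=\left(\partial_{x_{4l}}+\mathbf{i}\partial_{x_{4l+1}}+\mathbf{j}\partial_{x_{4l+2}}+\mathbf{k}\partial_{x_{4l+3}}\right)\left(\partial_{x_{4k}}-\mathbf{i}\partial_{x_{4k+1}}-\mathbf{j}\partial_{x_{4k+2}}-\mathbf{k}\partial_{x_{4k+3}}\right)u$$ in row $l$ and column $k$. Let $\det$ denote the Moore determinant of hyperhermitian matrices, $\det A=\sum_\sigma\operatorname{sgn}(\sigma)\prod a_{i_1i_2}a_{i_2i_3}\cdots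 a_{i_ri_1}$, the product being over the cycles $(i_1\,i_2\dots i_r)$ of $\sigma$ (fixed points included), each written with its smallest element first, and the cycles ordered so that their smallest elements decrease from left to right; it is a real number. Let the mixed discriminant $\det(A_1,\dots,A_n)$ be the coefficient of $\lambda_1\cdots\lambda_n$ in the real polynomial $\det(\lambda_1A_1+\dots+\lambda_nA_n)$, divided by $n!$, and write $\det(f_1,\dots,f_n)=\det(H(f_1),\dots,H(f_n))$. **Theorem.** For all real-valued $C^2$ functions $f_1,\dots,f_n$ on $\mathbb{H}^n$, at every point of $\mathbb{H}^n$, $$\triangle_n(f_1,\dots,f_n)=n!\,\det(f_1,\dots,f_n).$$ Consequently $\triangle_n$ coincides, up to the constant factor $n!$, with the quaternionic Monge–Ampère operator $u\mapsto\det H(u)$: for every real-valued $C^2$ function $u$ on $\mathbb{H}^n$, $$\triangle_n(u,\dots,u)=\triangle_nu=n!\,\det H(u).$$ -/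

import Mathlib

namespace QuatMA

noncomputable section

/-! ### First-order operators on `ℍⁿ`

A point of `ℍⁿ` is `q : Fin n → Quaternion ℝ`, and its real coordinates are given by
`q l = x_{4l} + x_{4l+1} i + x_{4l+2} j + x_{4l+3} k`. -/

/-- The real basis `1, i, j, k` of the quaternions. -/
def unit (a : Fin 4) : Quaternion ℝ :=
  match a with
  | 0 => ⟨1, 0, 0, 0⟩
  | 1 => ⟨0, 1, 0, 0⟩
  | 2 => ⟨0, 0, 1, 0⟩
  | 3 => ⟨0, 0, 0, 1⟩

/-- The real partial derivative `∂F/∂x_{4l+a}` of a function on `ℍⁿ`. -/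
def partialX {n : ℕ} {E : Type*} [NormedAddCommGroup E] [NormedSpace ℝ E]
    (l : Fin n) (a : Fin 4) (F : (Fin n → Quaternion ℝ) → E) (q : Fin n → Quaternion ℝ) : E :=
  fderiv ℝ F q (Pi.single l (unit a))

/-- The operators `∇_{jα}`. The row index `j = 2l + s ∈ 0, …, 2n-1` is written as the
pair `(l, s) : Fin n × Fin 2`. -/
def nabla {n : ℕ} (j : Fin n × Fin 2) (α : Fin 2) (F : (Fin n → Quaternion ℝ) → ℂ)
    (q : Fin n → Quaternion ℝ) : ℂ :=
  match j.2, α with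
  | 0, 0 => partialX j.1 0 F q + Complex.I * partialX j.1 1 F q
  | 0, 1 => -partialX j.1 2 F q - Complex.I * partialX j.1 3 F q
  | 1, 0 => partialX j.1 2 F q - Complex.I * partialX j.1 3 F q
  | 1, 1 => partialX j.1 0 F q - Complex.I * partialX j.1 1 F q

/-- `∇_{i0} ∇_{j1} u` for a real-valued function `u`. -/
def nabla2 {n : ℕ} (i j : Fin n × Fin 2) (u : (Fin n → Quaternion ℝ) → ℝ)
    (q : Fin n → Quaternion ℝ) : ℂ :=
  nabla i 0 (nabla j 1 (fun p => (u p : ℂ))) q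

/-- `△_{ij} u = (∇_{i0} ∇_{j1} u - ∇_{i1} ∇_{j0} u) / 2`, the coefficient of `ω^i ∧ ω^j` in
the Baston operator `△ u = ∑ △_{ij} u ω^i ∧ ω^j`. -/
def triangle {n : ℕ} (i j : Fin n × Fin 2) (u : (Fin n → Quaternion ℝ) → ℝ)
    (q : Fin n → Quaternion ℝ) : ℂ :=
  (nabla i 0 (nabla j 1 (fun p => (u p : ℂ))) q
    - nabla i 1 (nabla j 0 (fun p => (u p : ℂ))) q) / 2

open Classical in
/-- The symbol `δ^{i_1 j_1 … i_n j_n}_{0 1 … (2n-1)}`. The sequence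
`(i_1, j_1, …, i_n, j_n)` is the function `w` with `w (m, 0)` and `w (m, 1)` the `m`-th pair;
positions and values are both identified with `0, …, 2n-1` by `(l, s) ↦ 2l + s`. The value is
the sign of the permutation if `w` is one, and `0` otherwise. -/
def delta {n : ℕ} (w : Fin n × Fin 2 → Fin n × Fin 2) : ℂ :=
  if h : Function.Bijective w then
    (((Equiv.Perm.sign (Equiv.ofBijective w h) : ℤˣ) : ℤ) : ℂ)
  else 0

/-- `△_n(f_1, …, f_n)`: the coefficient of `△ f_1 ∧ … ∧ △ f_n` with respect to
`ω^0 ∧ ω^1 ∧ … ∧ ω^{2n-1}`, that is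
`∑ δ^{i_1 j_1 … i_n j_n}_{0 1 … (2n-1)} △_{i_1 j_1} f_1 ⋯ △_{i_n j_n} f_n`. -/
def bastonMixed {n : ℕ} (f : Fin n → (Fin n → Quaternion ℝ) → ℝ)
    (q : Fin n → Quaternion ℝ) : ℂ :=
  ∑ w : Fin n × Fin 2 → Fin n × Fin 2,
    delta w * ∏ m : Fin n, triangle (w (m, 0)) (w (m, 1)) (f m) q

/-- The operator `△_n u =
∑ δ^{i_1 j_1 … i_n j_n}_{0 1 … (2n-1)} ∇_{i_1 0} ∇_{j_1 1} u ⋯ ∇_{i_n 0} ∇_{j_n 1} u`. -/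
def baston {n : ℕ} (u : (Fin n → Quaternion ℝ) → ℝ) (q : Fin n → Quaternion ℝ) : ℂ :=
  ∑ w : Fin n × Fin 2 → Fin n × Fin 2,
    delta w * ∏ m : Fin n, nabla2 (w (m, 0)) (w (m, 1)) u q

/-! ### The quaternionic Hessian -/

/-- `∂/∂q̄_l = ∂_{x_{4l}} + i ∂_{x_{4l+1}} + j ∂_{x_{4l+2}} + k ∂_{x_{4l+3}}`. -/
def dqBar {n : ℕ} (l : Fin n) (F : (Fin n → Quaternion ℝ) → Quaternion ℝ)
    (q : Fin n → Quaternion ℝ) : Quaternion ℝ :=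
  ∑ a : Fin 4, unit a * partialX l a F q

/-- `∂/∂q_k = ∂_{x_{4k}} - i ∂_{x_{4k+1}} - j ∂_{x_{4k+2}} - k ∂_{x_{4k+3}}`. -/
def dq {n : ℕ} (k : Fin n) (F : (Fin n → Quaternion ℝ) → Quaternion ℝ)
    (q : Fin n → Quaternion ℝ) : Quaternion ℝ :=
  ∑ a : Fin 4, star (unit a) * partialX k a F q

/-- The quaternionic Hessian of a real-valued function: the hyperhermitian matrix whose entry
in row `l` and column `k` is `∂²u / ∂q̄_l ∂q_k`. -/
def hessian {n : ℕ} (u : (Fin n → Quaternion ℝ) → ℝ) (q : Fin n → Quaternion ℝ) :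
    Matrix (Fin n) (Fin n) (Quaternion ℝ) :=
  Matrix.of fun l k => dqBar l (dq k (fun p => (u p : Quaternion ℝ))) q

/-! ### The Moore determinant and the mixed discriminant -/

/-- The product `a_{i,σ(i)} a_{σ(i),σ²(i)} ⋯ a_{σ⁻¹(i),i}` along the cycle of `σ` through `i`,
beginning at `i`. -/
def cycleProd {R : Type*} [CommRing R] {n : ℕ} (A : Matrix (Fin n) (Fin n) (Quaternion R))
    (σ : Equiv.Perm (Fin n)) (i : Fin n) : Quaternion R :=
  ((List.range (Function.minimalPeriod σ i)).map
    fun k => A ((σ ^ k) i) ((σ ^ (k + 1)) i)).prod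

open Classical in
/-- The term of a permutation `σ` in Moore's determinant: each cycle (fixed points included)
begins with its smallest element, and the cycles are ordered so that these smallest elements
decrease from left to right. -/
def mooreTerm {R : Type*} [CommRing R] {n : ℕ} (A : Matrix (Fin n) (Fin n) (Quaternion R))
    (σ : Equiv.Perm (Fin n)) : Quaternion R :=
  (((List.finRange n).reverse.filter fun i => decide (∀ j, σ.SameCycle i j → i ≤ j)).map
    fun i => cycleProd A σ i).prod

/-- Moore's sum `∑_σ sgn(σ) ∏_{cycles} a_{i_1 i_2} a_{i_2 i_3} ⋯ a_{i_r i_1}`. -/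
def mooreSum {R : Type*} [CommRing R] {n : ℕ} (A : Matrix (Fin n) (Fin n) (Quaternion R)) :
    Quaternion R :=
  ∑ σ : Equiv.Perm (Fin n), ((Equiv.Perm.sign σ : ℤˣ) : ℤ) • mooreTerm A σ

/-- The Moore determinant of a hyperhermitian matrix. It is a scalar: for a hyperhermitian
matrix the three imaginary components of Moore's sum vanish. -/
def mooreDet {R : Type*} [CommRing R] {n : ℕ} (A : Matrix (Fin n) (Fin n) (Quaternion R)) : R :=
  (mooreSum A).re

/-- A real quaternion as a quaternion with coefficients in the polynomial ring
`ℝ[λ_1, …, λ_n]` (constant polynomials). -/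
def constPoly {n : ℕ} (x : Quaternion ℝ) : Quaternion (MvPolynomial (Fin n) ℝ) :=
  ⟨MvPolynomial.C x.re, MvPolynomial.C x.imI, MvPolynomial.C x.imJ, MvPolynomial.C x.imK⟩

/-- The polynomial `det(λ_1 A_1 + ⋯ + λ_n A_n)` in the real variables `λ_1, …, λ_n`. -/
def detPoly {n : ℕ} (A : Fin n → Matrix (Fin n) (Fin n) (Quaternion ℝ)) :
    MvPolynomial (Fin n) ℝ :=
  mooreDet (∑ m : Fin n,
    (MvPolynomial.X m : MvPolynomial (Fin n) ℝ) • (A m).map (constPoly (n := n)))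

/-- The mixed discriminant `det(A_1, …, A_n)`: the coefficient of `λ_1 ⋯ λ_n` in
`det(λ_1 A_1 + ⋯ + λ_n A_n)`, divided by `n!`. -/
def mixedDiscriminant {n : ℕ} (A : Fin n → Matrix (Fin n) (Fin n) (Quaternion ℝ)) : ℝ :=
  MvPolynomial.coeff (∑ m : Fin n, Finsupp.single m 1) (detPoly A) / (n.factorial : ℝ)

end

end QuatMA

/-! The complex representation `φ` of the quaternions turns `∂/∂q̄_l` into the `2 × 2` block
`(∇_{(2l+s)α})`, and `φ(star q)` is the adjugate of `φ(q)`. Hence the matrix `2 △_{ij} u` is the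
skew-symmetric matrix with blocks `φ(H(u)_{lk}) * J`, where `J = [[0, 1], [-1, 0]]`, and `△_n` is
`n!` times a (polarized) Pfaffian. The theorem thus reduces to the fact that Moore's determinant of
a hyperhermitian matrix `A` is the Pfaffian of the matrix with blocks `φ(A_{lk}) * J`.

To see this, average Moore's sum over the reversals of the cycles of each permutation. A reversal
conjugates the product `z` along the cycle, so the average replaces `z` by its real part. Since
`φ(z)` and `φ(star z)` average to the real part of `z` as well, Moore's sum is equally obtained from
the upper left entries of the matrices `φ(z)`. Expanding these matrix products gives a sum over the
pairs of a permutation `σ` and a labelling `s : Fin n → Fin 2` of the indices that vanishes at the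
least element of each cycle. Such pairs correspond to the perfect matchings of
`Fin n × Fin 2`: match `(m, s m)` with `(σ m, s (σ m) + 1)`. A matching is listed by `2 ^ n * n!`
permutations of `Fin n × Fin 2`, which contribute equally to the Pfaffian sum. -/

namespace QuatMA

noncomputable section

open Equiv Equiv.Perm Finset

/-! ### The complex representation of the quaternions -/

section complexRep

variable {R C : Type*} [CommRing R] [CommRing C] [Algebra R C]

/-- The representation of the quaternions by complex `2 × 2` matrices, over any commutative
`R`-algebra that contains a square root `I` of `-1`. -/
def complexRep {I : C} (hI : I * I = -1) : Quaternion R →ₐ[R] Matrix (Fin 2) (Fin 2) C :=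
  QuaternionAlgebra.Basis.liftHom
    { i := !![I, 0; 0, -I]
      j := !![0, -1; 1, 0]
      k := !![0, -I; -I, 0]
      i_mul_i := by ext s t; fin_cases s <;> fin_cases t <;> simp [hI]
      j_mul_j := by ext s t; fin_cases s <;> fin_cases t <;> simp
      i_mul_j := by simp
      j_mul_i := by simp }

variable {I : C} (hI : I * I = -1)

lemma complexRep_apply (x : Quaternion R) :
    complexRep hI x =
      !![algebraMap R C x.re + I * algebraMap R C x.imI,
        -algebraMap R C x.imJ - I * algebraMap R C x.imK;
        algebraMap R C x.imJ - I * algebraMap R C x.imK,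
        algebraMap R C x.re - I * algebraMap R C x.imI] := by
  change QuaternionAlgebra.Basis.lift _ x = _
  ext s t
  fin_cases s <;> fin_cases t <;>
    simp [QuaternionAlgebra.Basis.lift, Algebra.algebraMap_eq_smul_one, sub_eq_add_neg]

lemma complexRep_star (x : Quaternion R) :
    complexRep hI (star x) = (complexRep hI x).adjugate := by
  simp [complexRep_apply, Matrix.adjugate_fin_two_of, sub_eq_add_neg, add_comm]

lemma complexRep_apply_zero_zero_add_star (x : Quaternion R) :
    complexRep hI x 0 0 + complexRep hI (star x) 0 0 =
      algebraMap R C x.re + algebraMap R C x.re := by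
  simp [complexRep_apply, add_add_add_comm]

instance [IsAddTorsionFree R] : IsAddTorsionFree (Quaternion R) :=
  (QuaternionAlgebra.linearEquivTuple (-1 : R) 0 (-1)).injective.isAddTorsionFree
    (QuaternionAlgebra.linearEquivTuple (-1 : R) 0 (-1)).toLinearMap.toAddMonoidHom

end complexRep

/-! ### Reversing one cycle of a permutation -/

section invCycle

variable {α : Type*} [Fintype α] [DecidableEq α] {σ : Perm α} {i x y : α}

lemma commute_cycleOf (σ : Perm α) (i : α) : Commute σ (σ.cycleOf i) := by
  ext x
  by_cases h : σ.SameCycle i x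
  · simp [h.cycleOf_apply, h.apply_right.cycleOf_apply]
  · rw [mul_apply, mul_apply, cycleOf_apply_of_not_sameCycle h,
      cycleOf_apply_of_not_sameCycle (sameCycle_apply_right.not.2 h)]

/-- The permutation obtained from `σ` by inverting its cycle through `i`. -/
def invCycle (σ : Perm α) (i : α) : Perm α := σ * σ.cycleOf i ^ (-2 : ℤ)

lemma sign_invCycle (σ : Perm α) (i : α) : sign (invCycle σ i) = sign σ := by
  simp [invCycle, zpow_neg]

lemma invCycle_zpow (σ : Perm α) (i : α) (k : ℤ) :
    invCycle σ i ^ k = σ ^ k * σ.cycleOf i ^ (-2 * k) := by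
  rw [invCycle, ((commute_cycleOf σ i).zpow_right _).mul_zpow, zpow_mul]

lemma invCycle_zpow_apply_of_sameCycle (h : σ.SameCycle i x) (k : ℤ) :
    (invCycle σ i ^ k) x = (σ ^ (-k)) x := by
  rw [invCycle_zpow, h.cycleOf_eq, mul_apply, cycleOf_zpow_apply_self, ← mul_apply, ← zpow_add]
  congr 2
  ring

lemma invCycle_zpow_apply_of_not_sameCycle (h : ¬σ.SameCycle i x) (k : ℤ) :
    (invCycle σ i ^ k) x = (σ ^ k) x := by
  rw [invCycle_zpow, mul_apply,
    zpow_apply_eq_self_of_apply_eq_self (cycleOf_apply_of_not_sameCycle h)]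

lemma sameCycle_invCycle : (invCycle σ i).SameCycle x y ↔ σ.SameCycle x y := by
  by_cases h : σ.SameCycle i x
  · simp only [SameCycle, invCycle_zpow_apply_of_sameCycle h]
    exact (Equiv.neg ℤ).exists_congr fun _ => Iff.rfl
  · simp only [SameCycle, invCycle_zpow_apply_of_not_sameCycle h]

lemma invCycle_involutive (i : α) : Function.Involutive fun σ : Perm α => invCycle σ i := by
  intro σ
  ext x
  by_cases h : σ.SameCycle i x
  · simpa only [zpow_one, neg_neg] using
      (invCycle_zpow_apply_of_sameCycle (sameCycle_invCycle.2 h) 1).trans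
        (invCycle_zpow_apply_of_sameCycle h (-1))
  · simpa only [zpow_one] using
      (invCycle_zpow_apply_of_not_sameCycle (sameCycle_invCycle.not.2 h) 1).trans
        (invCycle_zpow_apply_of_not_sameCycle h 1)

end invCycle

/-! ### Moore's sum and cyclewise averaging -/

section cycleMins

variable {n : ℕ} {σ : Perm (Fin n)} {i j : Fin n}

open Classical in
/-- The smallest elements of the cycles of `σ` in decreasing order: the starting points of the
factors of Moore's determinant. -/
def cycleMins (σ : Perm (Fin n)) : List (Fin n) :=
  (List.finRange n).reverse.filter fun i => decide (∀ j, σ.SameCycle i j → i ≤ j)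

lemma mem_cycleMins : i ∈ cycleMins σ ↔ ∀ j, σ.SameCycle i j → i ≤ j := by
  simp [cycleMins]

lemma nodup_cycleMins (σ : Perm (Fin n)) : (cycleMins σ).Nodup :=
  (List.nodup_reverse.2 (List.nodup_finRange n)).filter _

lemma cycleMins_invCycle (σ : Perm (Fin n)) (i : Fin n) :
    cycleMins (invCycle σ i) = cycleMins σ := by
  simp only [cycleMins, sameCycle_invCycle]

lemma eq_of_mem_cycleMins_of_sameCycle (hi : i ∈ cycleMins σ) (hj : j ∈ cycleMins σ)
    (h : σ.SameCycle i j) : i = j :=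
  le_antisymm (mem_cycleMins.1 hi j h) (mem_cycleMins.1 hj i h.symm)

lemma exists_mem_cycleMins (σ : Perm (Fin n)) (l : Fin n) :
    ∃ i ∈ cycleMins σ, σ.SameCycle i l := by
  classical
  obtain ⟨i, hi, hmin⟩ := exists_min_image (univ.filter (σ.SameCycle l)) id
    ⟨l, by simpa using SameCycle.refl σ l⟩
  simp only [mem_filter_univ, id] at hi hmin
  exact ⟨i, mem_cycleMins.2 fun j hij => hmin j (hi.trans hij), hi.symm⟩

lemma exists_forall_list_prod_map_eq_mul_mul {ι M : Type*} [Monoid M] {l : List ι} {i : ι}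
    (hl : l.Nodup) (hi : i ∈ l) (f : ι → M) :
    ∃ a b, ∀ g : ι → M, (∀ j ∈ l, j ≠ i → g j = f j) → (l.map g).prod = a * g i * b := by
  obtain ⟨l₁, l₂, rfl⟩ := List.append_of_mem hi
  have hi' := (List.nodup_middle.1 hl).notMem
  refine ⟨(l₁.map f).prod, (l₂.map f).prod, fun g hg => ?_⟩
  have h₁ : l₁.map g = l₁.map f := List.map_congr_left fun j hj =>
    hg j (by simp [hj]) (by rintro rfl; simp [hj] at hi')
  have h₂ : l₂.map g = l₂.map f := List.map_congr_left fun j hj =>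
    hg j (by simp [hj]) (by rintro rfl; simp [hj] at hi')
  simp only [List.map_append, List.map_cons, List.prod_append, List.prod_cons, h₁, h₂, mul_assoc]

variable {S : Type*} [Ring S] [IsAddTorsionFree S] {f g : Perm (Fin n) → Fin n → S}

lemma sum_sign_smul_prod_cycleMins_congr_of_ne (i : Fin n)
    (hf : ∀ σ j, ¬σ.SameCycle i j → f (invCycle σ i) j = f σ j)
    (hne : ∀ σ j, j ≠ i → f σ j = g σ j)
    (hi : ∀ σ, f σ i + f (invCycle σ i) i = g σ i + g (invCycle σ i) i) :
    ∑ σ, (sign σ : ℤ) • ((cycleMins σ).map (f σ)).prod =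
      ∑ σ, (sign σ : ℤ) • ((cycleMins σ).map (g σ)).prod := by
  have double (F : Perm (Fin n) → S) :
      2 • ∑ σ, (sign σ : ℤ) • F σ = ∑ σ, (sign σ : ℤ) • (F σ + F (invCycle σ i)) := by
    simp only [smul_add, sum_add_distrib, two_smul]
    congr 1
    rw [← Equiv.sum_comp (invCycle_involutive i).toPerm]
    simp [sign_invCycle]
  refine nsmul_right_injective two_ne_zero ?_
  simp only [double]
  refine sum_congr rfl fun σ _ => congrArg _ ?_
  rw [cycleMins_invCycle]
  by_cases him : i ∈ cycleMins σ
  · obtain ⟨a, b, hab⟩ := exists_forall_list_prod_map_eq_mul_mul (nodup_cycleMins σ) him (f σ)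
    have hf' : ∀ j ∈ cycleMins σ, j ≠ i → f (invCycle σ i) j = f σ j := fun j hj hji =>
      hf σ j fun h => hji (eq_of_mem_cycleMins_of_sameCycle him hj h).symm
    rw [hab _ fun _ _ _ => rfl, hab _ hf', hab (g σ) fun j _ hji => (hne σ j hji).symm,
      hab (g (invCycle σ i)) fun j hj hji => (hne _ j hji).symm.trans (hf' j hj hji),
      ← add_mul, ← mul_add, hi, mul_add, add_mul]
  · have hfg (τ : Perm (Fin n)) : (cycleMins σ).map (f τ) = (cycleMins σ).map (g τ) :=
      List.map_congr_left fun j hj => hne τ j fun hji => him (hji ▸ hj)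
    rw [hfg, hfg]

lemma sum_sign_smul_prod_cycleMins_congr
    (hf : ∀ σ i j, ¬σ.SameCycle i j → f (invCycle σ i) j = f σ j)
    (hg : ∀ σ i j, ¬σ.SameCycle i j → g (invCycle σ i) j = g σ j)
    (hfg : ∀ σ i, f σ i + f (invCycle σ i) i = g σ i + g (invCycle σ i) i) :
    ∑ σ, (sign σ : ℤ) • ((cycleMins σ).map (f σ)).prod =
      ∑ σ, (sign σ : ℤ) • ((cycleMins σ).map (g σ)).prod := by
  suffices h : ∀ K : Finset (Fin n), ∑ σ, (sign σ : ℤ) • ((cycleMins σ).map (f σ)).prod =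
      ∑ σ, (sign σ : ℤ) • ((cycleMins σ).map (K.piecewise (g σ) (f σ))).prod by
    simpa using h univ
  intro K
  induction K using Finset.induction_on with
  | empty => simp
  | insert i K hi ih =>
    rw [ih]
    refine sum_sign_smul_prod_cycleMins_congr_of_ne i (fun σ j h => ?_) (fun σ j hji => ?_)
      fun σ => ?_
    · by_cases hj : j ∈ K <;> simp [hj, hf σ i j h, hg σ i j h]
    · simp [piecewise_insert_of_ne, hji]
    · simp [hi, hfg]

end cycleMins

section cycleProd

variable {R : Type*} [CommRing R] {n : ℕ} (A : Matrix (Fin n) (Fin n) (Quaternion R))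

lemma cycleProd_invCycle_of_not_sameCycle {σ : Perm (Fin n)} {i j : Fin n}
    (h : ¬σ.SameCycle i j) : cycleProd A (invCycle σ i) j = cycleProd A σ j := by
  have hpow (k : ℕ) : (invCycle σ i ^ k) j = (σ ^ k) j :=
    mod_cast invCycle_zpow_apply_of_not_sameCycle h k
  have hperiod : Function.minimalPeriod (invCycle σ i) j = Function.minimalPeriod σ j :=
    Function.minimalPeriod_eq_minimalPeriod_iff.2 fun k => by
      simp only [Function.IsPeriodicPt, Function.IsFixedPt, iterate_eq_pow, hpow]
  simp only [cycleProd, hperiod, hpow]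

lemma star_list_prod {M : Type*} [Monoid M] [StarMul M] (l : List M) :
    star l.prod = (l.map star).reverse.prod := by
  induction l with
  | nil => simp
  | cons a l ih => simp [ih]

lemma minimalPeriod_invCycle_self (σ : Perm (Fin n)) (i : Fin n) :
    Function.minimalPeriod (invCycle σ i) i = Function.minimalPeriod σ i := by
  refine Function.minimalPeriod_eq_minimalPeriod_iff.2 fun k => ?_
  have h := invCycle_zpow_apply_of_sameCycle (SameCycle.refl σ i) k
  rw [zpow_natCast, zpow_neg, zpow_natCast] at h
  rw [Function.IsPeriodicPt, Function.IsPeriodicPt, Function.IsFixedPt, Function.IsFixedPt,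
    iterate_eq_pow, iterate_eq_pow, h, inv_eq_iff_eq, eq_comm]

lemma cycleProd_invCycle_self (hA : A.IsHermitian) (σ : Perm (Fin n)) (i : Fin n) :
    cycleProd A (invCycle σ i) i = star (cycleProd A σ i) := by
  have hpow (a b : ℕ) (hab : a + b = Function.minimalPeriod σ i) :
      (invCycle σ i ^ a) i = (σ ^ b) i := by
    rw [← zpow_natCast, invCycle_zpow_apply_of_sameCycle (SameCycle.refl σ i), zpow_neg,
      zpow_natCast, inv_eq_iff_eq, ← mul_apply, ← pow_add, hab, ← iterate_eq_pow,
      Function.iterate_minimalPeriod]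
  rw [cycleProd, cycleProd, star_list_prod, minimalPeriod_invCycle_self]
  congr 1
  refine List.ext_getElem (by simp) fun k h _ => ?_
  rw [List.length_map, List.length_range] at h
  simp only [List.getElem_map, List.getElem_range, List.getElem_reverse, List.length_map,
    List.length_range, hA.apply]
  rw [hpow k (Function.minimalPeriod σ i - 1 - k + 1) (by lia),
    hpow (k + 1) (Function.minimalPeriod σ i - 1 - k) (by lia)]

end cycleProd

section mooreDet

variable {R C : Type*} [CommRing R] [CommRing C] [Algebra R C] [IsAddTorsionFree R] {n : ℕ}
  {A : Matrix (Fin n) (Fin n) (Quaternion R)}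

lemma mooreSum_eq_coe (hA : A.IsHermitian) :
    mooreSum A =
      ↑(∑ σ, (sign σ : ℤ) • ((cycleMins σ).map fun i => (cycleProd A σ i).re).prod) := by
  have h : mooreSum A = ∑ σ, (sign σ : ℤ) •
      ((cycleMins σ).map fun i => ((cycleProd A σ i).re : Quaternion R)).prod := by
    refine sum_sign_smul_prod_cycleMins_congr
      (fun σ i j h => cycleProd_invCycle_of_not_sameCycle A h)
      (fun σ i j h => by rw [cycleProd_invCycle_of_not_sameCycle A h]) fun σ i => ?_
    rw [cycleProd_invCycle_self A hA, Quaternion.re_star, Quaternion.self_add_star, two_mul]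
  rw [h, ← Quaternion.algebraMap_def]
  simp only [map_sum, map_zsmul, map_list_prod, List.map_map, Function.comp_def]

lemma algebraMap_mooreDet_eq_sum_cycleMins [IsAddTorsionFree C] {I : C} (hI : I * I = -1)
    (hA : A.IsHermitian) :
    algebraMap R C (mooreDet A) = ∑ σ, (sign σ : ℤ) •
      ((cycleMins σ).map fun i => complexRep hI (cycleProd A σ i) 0 0).prod := by
  rw [mooreDet, mooreSum_eq_coe hA, Quaternion.re_coe]
  simp only [map_sum, map_zsmul, map_list_prod, List.map_map, Function.comp_def]
  refine sum_sign_smul_prod_cycleMins_congr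
    (fun σ i j h => by rw [cycleProd_invCycle_of_not_sameCycle A h])
    (fun σ i j h => by rw [cycleProd_invCycle_of_not_sameCycle A h]) fun σ i => ?_
  rw [cycleProd_invCycle_self A hA, complexRep_apply_zero_zero_add_star, Quaternion.re_star]

end mooreDet

/-! ### Products along cycles as sums over index functions -/

section cycleEquiv

variable {ι C : Type*} [Fintype ι] [DecidableEq ι] [CommSemiring C] {n : ℕ}

lemma list_prod_matrix_apply (N : ℕ → Matrix ι ι C) (a b : ι) (p : ℕ) :
    ((List.range (p + 1)).map N).prod a b =
      ∑ s : Fin (p + 1) → ι, if s 0 = a then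
        ∏ k : Fin (p + 1), N k (s k) ((Fin.snoc s b : Fin (p + 2) → ι) k.succ) else 0 := by
  induction p generalizing b with
  | zero =>
    rw [← (Equiv.funUnique (Fin 1) ι).symm.sum_comp]
    simp [Fin.snoc]
  | succ p ih =>
    rw [List.range_succ, List.map_append, List.prod_append, Matrix.mul_apply,
      ← (Fin.snocEquiv fun _ : Fin (p + 2) => ι).sum_comp, Fintype.sum_prod_type]
    refine sum_congr rfl fun c _ => ?_
    rw [ih, sum_mul]
    refine sum_congr rfl fun s _ => ?_
    have h0 : (Fin.snoc s c : Fin (p + 2) → ι) 0 = s 0 :=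
      Fin.snoc_castSucc (α := fun _ => ι) c s 0
    simp only [Fin.snocEquiv_apply, h0, ite_mul, zero_mul]
    rw [Fin.prod_univ_castSucc (n := p + 1)]
    simp only [Fin.snoc_castSucc, Fin.succ_castSucc, Fin.snoc_last, Fin.succ_last]
    simp

lemma list_prod_matrix_apply_self (N : ℕ → Matrix ι ι C) (a : ι) (p : ℕ) [NeZero p] :
    ((List.range p).map N).prod a a =
      ∑ s : Fin p → ι, if s 0 = a then ∏ k : Fin p, N k (s k) (s (k + 1)) else 0 := by
  obtain _ | p := p
  · exact absurd rfl (NeZero.ne 0)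
  refine (list_prod_matrix_apply N a a p).trans (sum_congr rfl fun s _ => ?_)
  split_ifs with hs
  · refine prod_congr rfl fun k _ => ?_
    induction k using Fin.lastCases with
    | last => simp [hs]
    | cast k => rw [Fin.succ_castSucc, Fin.snoc_castSucc, Fin.coeSucc_eq_succ]
  · rfl

instance (σ : Perm (Fin n)) (i : Fin n) : NeZero (Function.minimalPeriod σ i) :=
  ⟨(Function.minimalPeriod_pos_of_mem_periodicPts
    (σ.injective.mem_periodicPts i)).ne'⟩

/-- A permutation splits its domain into cycles, each of them enumerated from its smallest
element on. -/
def cycleEquiv (σ : Perm (Fin n)) :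
    (Σ i : {i // i ∈ cycleMins σ}, Fin (Function.minimalPeriod σ i.1)) ≃ Fin n :=
  Equiv.ofBijective (fun x => (σ ^ (x.2 : ℕ)) x.1.1) <| by
    constructor
    · rintro ⟨⟨i, hi⟩, k⟩ ⟨⟨j, hj⟩, m⟩ (h : (σ ^ (k : ℕ)) i = (σ ^ (m : ℕ)) j)
      have hij : σ.SameCycle i j :=
        sameCycle_pow_left.1 (sameCycle_pow_right.1 (h.sameCycle σ))
      obtain rfl := eq_of_mem_cycleMins_of_sameCycle hi hj hij
      rw [← iterate_eq_pow, ← iterate_eq_pow] at h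
      rw [Fin.ext (Function.iterate_injOn_Iio_minimalPeriod k.2 m.2 h)]
    · intro l
      obtain ⟨i, hi, hil⟩ := exists_mem_cycleMins σ l
      obtain ⟨k, -, hk⟩ := hil.exists_pow_eq'
      refine ⟨⟨⟨i, hi⟩, Fin.ofNat _ k⟩, ?_⟩
      simp only [Fin.val_ofNat]
      rw [← iterate_eq_pow, Function.iterate_mod_minimalPeriod_eq, iterate_eq_pow, hk]

lemma cycleEquiv_apply (σ : Perm (Fin n))
    (x : Σ i : {i // i ∈ cycleMins σ}, Fin (Function.minimalPeriod σ i.1)) :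
    cycleEquiv σ x = (σ ^ (x.2 : ℕ)) x.1.1 := rfl

lemma cycleEquiv_zero (σ : Perm (Fin n)) (i : {i // i ∈ cycleMins σ}) :
    cycleEquiv σ ⟨i, 0⟩ = i := by
  simp [cycleEquiv_apply]

lemma cycleEquiv_add_one (σ : Perm (Fin n)) (i : {i // i ∈ cycleMins σ})
    (k : Fin (Function.minimalPeriod σ i.1)) :
    cycleEquiv σ ⟨i, k + 1⟩ = σ (cycleEquiv σ ⟨i, k⟩) := by
  rw [cycleEquiv_apply, cycleEquiv_apply, Fin.val_add, Fin.val_one', Nat.add_mod_mod,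
    ← iterate_eq_pow, Function.iterate_mod_minimalPeriod_eq, Function.iterate_succ_apply',
    iterate_eq_pow]

lemma prod_cycleMins_eq_sum (σ : Perm (Fin n)) (N : Fin n → Matrix ι ι C) (a : ι) :
    ((cycleMins σ).map fun i =>
        ((List.range (Function.minimalPeriod σ i)).map fun k => N ((σ ^ k) i)).prod a a).prod =
      ∑ s : Fin n → ι, if ∀ i ∈ cycleMins σ, s i = a then ∏ l, N l (s l) (s (σ l)) else 0 := by
  let e := ((cycleEquiv σ).symm.arrowCongr (Equiv.refl ι)).trans (Equiv.piCurry fun _ _ => ι)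
  have he (s : Fin n → ι) (i) (k) : e s i k = s (cycleEquiv σ ⟨i, k⟩) := rfl
  rw [← List.prod_toFinset _ (nodup_cycleMins σ),
    Finset.prod_subtype (p := (· ∈ cycleMins σ)) (F := inferInstance) _ fun _ => List.mem_toFinset]
  simp only [list_prod_matrix_apply_self]
  rw [Fintype.prod_sum, ← e.sum_comp]
  refine sum_congr rfl fun s _ => ?_
  simp only [Finset.prod_ite_zero, he, cycleEquiv_zero, cycleEquiv_add_one, mem_univ,
    forall_const, Subtype.forall]
  congr 1
  rw [← (cycleEquiv σ).prod_comp, Fintype.prod_sigma]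
  rfl

lemma algebraMap_mooreDet_eq_sum {R C : Type*} [CommRing R] [CommRing C] [Algebra R C]
    [IsAddTorsionFree R] [IsAddTorsionFree C] {I : C} (hI : I * I = -1)
    {A : Matrix (Fin n) (Fin n) (Quaternion R)} (hA : A.IsHermitian) :
    algebraMap R C (mooreDet A) = ∑ σ : Perm (Fin n), ∑ s : Fin n → Fin 2,
      if ∀ i ∈ cycleMins σ, s i = 0 then
        (sign σ : ℤ) • ∏ l, complexRep hI (A l (σ l)) (s l) (s (σ l)) else 0 := by
  rw [algebraMap_mooreDet_eq_sum_cycleMins hI hA]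
  refine sum_congr rfl fun σ _ => ?_
  have h := prod_cycleMins_eq_sum σ (fun l => complexRep hI (A l (σ l))) 0
  simp only [← mul_apply, ← pow_succ'] at h
  simp only [cycleProd, map_list_prod, List.map_map, Function.comp_def, h, smul_sum, smul_ite,
    smul_zero]

end cycleEquiv

/-! ### Perfect matchings of `ι × Fin 2` -/

section twist

variable {ι : Type*}

/-- The permutation that exchanges the two elements `(l, 0)` and `(l, 1)` for `e l = 1` and fixes
both for `e l = 0`. -/
def twist (e : ι → Fin 2) : Perm (ι × Fin 2) := prodCongrRight fun l => Equiv.addRight (e l)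

@[simp]
lemma twist_apply (e : ι → Fin 2) (x : ι × Fin 2) : twist e x = (x.1, x.2 + e x.1) := rfl

@[simp]
lemma twist_mul_self (e : ι → Fin 2) : twist e * twist e = 1 := by
  have h : ∀ t s : Fin 2, t + s + s = t := by decide
  ext1 x
  simp [h]

lemma twist_one_apply_ne (x : ι × Fin 2) : twist 1 x ≠ x := by
  have h : ∀ t : Fin 2, t + 1 ≠ t := by decide
  exact fun hx => h x.2 (congrArg Prod.snd hx)

/-- The permutation `(m, 0) ↦ (m, s m)`, `(m, 1) ↦ (σ m, s (σ m) + 1)`. It stands for the perfect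
matching of `ι × Fin 2` whose pairs are the images of the pairs `{(m, 0), (m, 1)}`. -/
def pairPerm (σ : Perm ι) (s : ι → Fin 2) : Perm (ι × Fin 2) :=
  twist s * prodCongrLeft ![1, σ]

lemma pairPerm_zero (σ : Perm ι) (s : ι → Fin 2) (m : ι) : pairPerm σ s (m, 0) = (m, s m) := by
  simp [pairPerm]

lemma pairPerm_one (σ : Perm ι) (s : ι → Fin 2) (m : ι) :
    pairPerm σ s (m, 1) = twist 1 (σ m, s (σ m)) := by
  simp [pairPerm, add_comm]

/-- The permutation `(m, t) ↦ (π m, t + e (π m))`, which permutes the pairs `{(m, 0), (m, 1)}`. -/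
def blockPerm (π : Perm ι) (e : ι → Fin 2) : Perm (ι × Fin 2) :=
  twist e * prodCongrLeft fun _ => π

@[simp]
lemma blockPerm_apply (π : Perm ι) (e : ι → Fin 2) (x : ι × Fin 2) :
    blockPerm π e x = (π x.1, x.2 + e (π x.1)) := by
  simp [blockPerm]

lemma blockPerm_injective :
    Function.Injective fun a : Perm ι × (ι → Fin 2) => blockPerm a.1 a.2 := by
  rintro ⟨π, e⟩ ⟨π', e'⟩ h
  have h' (m : ι) : π m = π' m ∧ e (π m) = e' (π' m) := by
    simpa using Equiv.congr_fun h (m, 0)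
  obtain rfl : π = π' := Equiv.ext fun m => (h' m).1
  have he : e = e' := funext fun l => by simpa using (h' (π.symm l)).2
  rw [he]

lemma commute_blockPerm_twist_one (π : Perm ι) (e : ι → Fin 2) :
    Commute (blockPerm π e) (twist 1) := by
  ext1 x
  simp [add_right_comm]

lemma exists_eq_blockPerm_of_commute [Finite ι] {g : Perm (ι × Fin 2)}
    (hg : Commute g (twist 1)) : ∃ π e, g = blockPerm π e := by
  have hg' (m : ι) : g (m, 1) = twist 1 (g (m, 0)) := by
    simpa using Equiv.congr_fun hg.eq (m, 0)
  have hinj : Function.Injective fun m => (g (m, 0)).1 := by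
    have h2 : ∀ t t' : Fin 2, t = t' ∨ t = t' + 1 := by decide
    intro m m' (h : (g (m, 0)).1 = (g (m', 0)).1)
    obtain ht | ht := h2 (g (m, 0)).2 (g (m', 0)).2
    · exact congrArg Prod.fst (g.injective (Prod.ext h ht))
    · have hflip : g (m, 0) = twist 1 (g (m', 0)) := Prod.ext h ht
      exact congrArg Prod.fst (g.injective (hflip.trans (hg' m').symm))
  let π : Perm ι := Equiv.ofBijective _ (Finite.injective_iff_bijective.1 hinj)
  refine ⟨π, fun l => (g (π.symm l, 0)).2, Equiv.ext fun ⟨m, t⟩ => ?_⟩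
  rw [blockPerm_apply, Equiv.symm_apply_apply]
  obtain rfl | rfl := Fin.exists_fin_two.1 ⟨t, rfl⟩
  · simp [π]
  · rw [hg', twist_apply, add_comm]
    rfl

variable [Fintype ι] [DecidableEq ι]

lemma sign_twist (e : ι → Fin 2) : (sign (twist e) : ℤ) = ∏ l, (-1) ^ (e l : ℕ) := by
  have h : ∀ a : Fin 2, (sign (Equiv.addRight a) : ℤ) = (-1) ^ (a : ℕ) := by decide
  rw [twist, sign_prodCongrRight, Units.coe_prod]
  exact prod_congr rfl fun l _ => h (e l)

lemma sign_pairPerm (σ : Perm ι) (s : ι → Fin 2) :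
    (sign (pairPerm σ s) : ℤ) = (∏ l, (-1) ^ (s l : ℕ)) * sign σ := by
  rw [pairPerm, Perm.sign_mul, Units.val_mul, sign_twist, sign_prodCongrLeft]
  simp

lemma sign_prodCongrLeft_const (π : Perm ι) :
    sign (prodCongrLeft fun _ : Fin 2 => π) = 1 := by
  simp [sign_prodCongrLeft]

end twist

section matching

lemma not_sameCycle_mul_apply_of_involutive {α : Type*} {a b : Perm α} (ha : a * a = 1)
    (hb : b * b = 1) (ha' : ∀ x, a x ≠ x) (hb' : ∀ x, b x ≠ x) (x : α) :
    ¬(a * b).SameCycle x (a x) := by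
  have hinv : (a * b)⁻¹ = b * a := by
    rw [mul_inv_rev, inv_eq_of_mul_eq_one_left ha, inv_eq_of_mul_eq_one_left hb]
  have hconj (k : ℤ) (y : α) : a (((a * b) ^ k) y) = ((a * b) ^ (-k)) (a y) := by
    have h : SemiconjBy a (a * b) (a * b)⁻¹ := by
      rw [SemiconjBy, hinv, ← mul_assoc, ha, mul_assoc, ha, one_mul, mul_one]
    rw [zpow_neg, ← inv_zpow]
    exact Equiv.congr_fun (h.zpow_right k).eq y
  rintro ⟨k, hk⟩
  obtain ⟨j, rfl | rfl⟩ := Int.even_or_odd' k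
  · refine ha' (((a * b) ^ j) x) ?_
    rw [hconj, ← hk, ← Perm.mul_apply, ← zpow_add]
    congr 2
    ring
  · refine hb' (((a * b) ^ j) x) ?_
    have hab : b (((a * b) ^ j) x) = a (((a * b) ^ (1 + j)) x) := by
      rw [zpow_add, zpow_one, Perm.mul_apply, Perm.mul_apply, ← Perm.mul_apply a a, ha,
        Perm.one_apply]
    rw [hab, hconj, ← hk, ← Perm.mul_apply, ← zpow_add]
    congr 2
    ring

lemma sameCycle_apply_iff_of_semiconj {α β : Type*} [Finite α] [Finite β] {f : α → β}
    {σ : Perm α} {ρ : Perm β} (h : Function.Semiconj f σ ρ) (x : α) (y : β) :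
    ρ.SameCycle (f x) y ↔ ∃ x', f x' = y ∧ σ.SameCycle x x' := by
  constructor
  · intro hy
    obtain ⟨k, -, rfl⟩ := hy.exists_pow_eq'
    exact ⟨(σ ^ k) x, by simpa only [Perm.coe_pow] using h.iterate_right k x, k, by simp⟩
  · rintro ⟨_, rfl, hx⟩
    obtain ⟨k, -, rfl⟩ := hx.exists_pow_eq'
    exact ⟨k, by simpa only [zpow_natCast, Perm.coe_pow] using (h.iterate_right k x).symm⟩

lemma semiconjBy_pairPerm_iff {ι : Type*} {σ : Perm ι} {s : ι → Fin 2} {τ : Perm (ι × Fin 2)}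
    (hτ : τ * τ = 1) : SemiconjBy (pairPerm σ s) (twist 1) τ ↔
      Function.Semiconj (fun m => (m, s m)) σ ⇑(twist 1 * τ : Perm (ι × Fin 2)) := by
  have hflip (x : ι × Fin 2) : twist 1 (twist 1 x) = x :=
    Equiv.congr_fun (twist_mul_self 1) x
  have hinvol (x : ι × Fin 2) : τ (τ x) = x := Equiv.congr_fun hτ x
  have h0 (m : ι) : twist 1 (m, (0 : Fin 2)) = (m, 1) := by simp
  have h1 (m : ι) : twist 1 (m, (1 : Fin 2)) = (m, 0) := by simp
  refine ⟨fun h m => ?_, fun h => Equiv.ext fun ⟨m, t⟩ => ?_⟩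
  · have hm := Equiv.congr_fun h.eq (m, 0)
    rw [Perm.mul_apply, Perm.mul_apply, h0, pairPerm_zero, pairPerm_one] at hm
    rw [Perm.mul_apply, ← hm, hflip]
  · have hm : twist 1 (σ m, s (σ m)) = τ (m, s m) := (congrArg (twist 1) (h m)).trans (hflip _)
    rw [Perm.mul_apply, Perm.mul_apply]
    obtain rfl | rfl := Fin.exists_fin_two.1 ⟨t, rfl⟩
    · rw [h0, pairPerm_zero, pairPerm_one, hm]
    · rw [h1, pairPerm_zero, pairPerm_one, hm, hinvol]

variable {n : ℕ} {ρ : Perm (Fin n × Fin 2)} {σ : Perm (Fin n)} {s : Fin n → Fin 2}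

/-- Let `ρ` be a permutation of `Fin n × Fin 2` whose cycles are exchanged in pairs by `twist 1`.
From each such pair of cycles, this set contains the one through `(i, 0)`, where `i` is the least
first coordinate that occurs. -/
def leastSide (ρ : Perm (Fin n × Fin 2)) : Set (Fin n × Fin 2) :=
  {x | ∃ i, ρ.SameCycle (i, 0) x ∧ ∀ y, ρ.SameCycle (i, 0) y → i ≤ y.1}

lemma apply_mem_leastSide {x : Fin n × Fin 2} (hx : x ∈ leastSide ρ) : ρ x ∈ leastSide ρ := by
  obtain ⟨i, hi, hmin⟩ := hx
  exact ⟨i, sameCycle_apply_right.2 hi, hmin⟩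

lemma mem_leastSide_or_twist_one_mem
    (hflip : ∀ ⦃x y⦄, ρ.SameCycle x y → ρ.SameCycle (twist 1 x) (twist 1 y)) (x : Fin n × Fin 2) :
    x ∈ leastSide ρ ∨ twist 1 x ∈ leastSide ρ := by
  classical
  have hside (y : Fin n × Fin 2) : (y.1, 0) = y ∨ (y.1, 0) = twist 1 y := by
    obtain ⟨i, t⟩ := y
    obtain rfl | rfl := Fin.exists_fin_two.1 ⟨t, rfl⟩ <;> simp
  have hcancel (y : Fin n × Fin 2) : twist 1 (twist 1 y) = y :=
    Equiv.congr_fun (twist_mul_self 1) y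
  let S : Set (Fin n) := {i | ρ.SameCycle (i, 0) x ∨ ρ.SameCycle (i, 0) (twist 1 x)}
  have hS (y : Fin n × Fin 2) (hy : ρ.SameCycle y x ∨ ρ.SameCycle y (twist 1 x)) : y.1 ∈ S := by
    obtain h | h := hside y
    · exact h ▸ hy
    · rw [Set.mem_ofPred_eq, h]
      exact hy.symm.imp (fun hyx => hcancel x ▸ hflip hyx) fun hyx => hflip hyx
  obtain ⟨i, hi, hmin⟩ := S.exists_min_image id S.toFinite ⟨x.1, hS x (Or.inl (.refl _ _))⟩
  refine hi.imp (fun h => ⟨i, h, fun y hy => ?_⟩) fun h => ⟨i, h, fun y hy => ?_⟩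
  · exact hmin _ (hS y (Or.inl (hy.symm.trans h)))
  · exact hmin _ (hS y (Or.inr (hy.symm.trans h)))

lemma twist_one_notMem_leastSide
    (hflip : ∀ ⦃x y⦄, ρ.SameCycle x y → ρ.SameCycle (twist 1 x) (twist 1 y))
    (hne : ∀ x, ¬ρ.SameCycle x (twist 1 x)) {x : Fin n × Fin 2} (hx : x ∈ leastSide ρ) :
    twist 1 x ∉ leastSide ρ := by
  rintro ⟨j, hj, hjmin⟩
  obtain ⟨i, hi, himin⟩ := hx
  have hcancel : twist 1 (twist 1 x) = x := Equiv.congr_fun (twist_mul_self 1) x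
  have hji : j ≤ i := hjmin (twist 1 (i, 0)) (hj.trans (hflip hi).symm)
  have hij : i ≤ j := himin (twist 1 (j, 0)) (hi.trans (hcancel ▸ hflip hj).symm)
  obtain rfl := hij.antisymm hji
  exact hne x (hi.symm.trans hj)

lemma existsUnique_mem_leastSide
    (hflip : ∀ ⦃x y⦄, ρ.SameCycle x y → ρ.SameCycle (twist 1 x) (twist 1 y))
    (hne : ∀ x, ¬ρ.SameCycle x (twist 1 x)) (l : Fin n) : ∃! t, (l, t) ∈ leastSide ρ := by
  have hexists : ∃ t, (l, t) ∈ leastSide ρ :=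
    (mem_leastSide_or_twist_one_mem hflip (l, 0)).elim (fun h => ⟨_, h⟩) fun h => ⟨_, h⟩
  obtain ⟨t, ht⟩ := hexists
  refine ⟨t, ht, fun t' ht' => by_contra fun hne' => ?_⟩
  have h2 : ∀ t t' : Fin 2, t' ≠ t → t' = t + 1 := by decide
  obtain rfl := h2 t t' hne'
  exact twist_one_notMem_leastSide hflip hne ht ht'

lemma mem_leastSide_of_semiconj (hs : ∀ i ∈ cycleMins σ, s i = 0)
    (h : Function.Semiconj (fun m => (m, s m)) σ ρ) (l : Fin n) : (l, s l) ∈ leastSide ρ := by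
  obtain ⟨i, hi, hil⟩ := exists_mem_cycleMins σ l
  have hcycle (y : Fin n × Fin 2) :
      ρ.SameCycle (i, 0) y ↔ ∃ m, (m, s m) = y ∧ σ.SameCycle i m := by
    rw [← hs i hi]
    exact sameCycle_apply_iff_of_semiconj h i y
  refine ⟨i, (hcycle _).2 ⟨l, rfl, hil⟩, fun y hy => ?_⟩
  obtain ⟨m, rfl, him⟩ := (hcycle y).1 hy
  exact mem_cycleMins.1 hi m him

lemma exists_semiconj_of_existsUnique_mem_leastSide
    (hρ : ∀ l, ∃! t, (l, t) ∈ leastSide ρ) :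
    ∃ σ : Perm (Fin n), ∃ s : Fin n → Fin 2, (∀ i ∈ cycleMins σ, s i = 0) ∧
      Function.Semiconj (fun m => (m, s m)) σ ρ := by
  choose s hs hunique using hρ
  have hsnd (l : Fin n) : ρ (l, s l) = ((ρ (l, s l)).1, s (ρ (l, s l)).1) :=
    Prod.ext rfl (hunique _ _ (apply_mem_leastSide (hs l)))
  have hinj : Function.Injective fun l => (ρ (l, s l)).1 := by
    intro l m (hlm : (ρ (l, s l)).1 = (ρ (m, s m)).1)
    have heq : ρ (l, s l) = ρ (m, s m) := by rw [hsnd l, hsnd m, hlm]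
    exact congrArg Prod.fst (ρ.injective heq)
  let σ : Perm (Fin n) := Equiv.ofBijective _ (Finite.injective_iff_bijective.1 hinj)
  have h : Function.Semiconj (fun m => (m, s m)) σ ρ := fun l => (hsnd l).symm
  refine ⟨σ, s, fun i hi => ?_, h⟩
  obtain ⟨j, hj, hmin⟩ := hs i
  obtain ⟨_, hm, him⟩ := (sameCycle_apply_iff_of_semiconj h i _).1 hj.symm
  obtain ⟨rfl, hs0⟩ := Prod.mk.inj hm
  obtain rfl := (mem_cycleMins.1 hi _ him).antisymm (hmin _ hj)
  exact hs0

lemma existsUnique_semiconjBy_pairPerm {τ : Perm (Fin n × Fin 2)} (hτ : τ * τ = 1)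
    (hτ' : ∀ x, τ x ≠ x) : ∃! a : Perm (Fin n) × (Fin n → Fin 2),
      (∀ i ∈ cycleMins a.1, a.2 i = 0) ∧ SemiconjBy (pairPerm a.1 a.2) (twist 1) τ := by
  -- Following alternately the matching `τ` and `twist 1` runs through each cycle of `σ` twice, once
  -- per direction; `leastSide` selects the direction in which `s` vanishes at the least element.
  set ρ := twist 1 * τ with hρ
  have hne (x : Fin n × Fin 2) : ¬ρ.SameCycle x (twist 1 x) :=
    not_sameCycle_mul_apply_of_involutive (twist_mul_self 1) hτ twist_one_apply_ne hτ' x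
  have hflip ⦃x y : Fin n × Fin 2⦄ (h : ρ.SameCycle x y) :
      ρ.SameCycle (twist 1 x) (twist 1 y) := by
    have hconj : twist 1 * ρ * (twist 1)⁻¹ = ρ⁻¹ := by
      rw [hρ, ← mul_assoc, twist_mul_self, one_mul, mul_inv_rev, inv_eq_of_mul_eq_one_left hτ]
    exact sameCycle_inv.1 (hconj ▸ h.conj)
  have hside := existsUnique_mem_leastSide hflip hne
  simp only [semiconjBy_pairPerm_iff hτ, ← hρ]
  obtain ⟨σ, s, hs, hsemi⟩ := exists_semiconj_of_existsUnique_mem_leastSide hside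
  refine ⟨(σ, s), ⟨hs, hsemi⟩, fun ⟨σ', s'⟩ ⟨hs', hsemi'⟩ => ?_⟩
  obtain rfl : s' = s := funext fun l => (hside l).unique
    (mem_leastSide_of_semiconj hs' hsemi' l) (mem_leastSide_of_semiconj hs hsemi l)
  obtain rfl : σ' = σ := Equiv.ext fun l =>
    congrArg Prod.fst ((hsemi' l).trans (hsemi l).symm)
  rfl

lemma bijective_pairPerm_mul_blockPerm (n : ℕ) :
    Function.Bijective fun a : {a : Perm (Fin n) × (Fin n → Fin 2) //
        ∀ i ∈ cycleMins a.1, a.2 i = 0} × (Perm (Fin n) × (Fin n → Fin 2)) =>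
      pairPerm a.1.1.1 a.1.1.2 * blockPerm a.2.1 a.2.2 := by
  have hmatch (w : Perm (Fin n × Fin 2)) := existsUnique_semiconjBy_pairPerm
    (τ := w * twist 1 * w⁻¹) (by simp [mul_assoc, ← mul_assoc (twist 1) (twist 1)])
    fun x hx => twist_one_apply_ne (w⁻¹ x) (by simpa [← Equiv.eq_symm_apply] using hx)
  have hsemi (w v b : Perm (Fin n × Fin 2)) (hw : v * b = w) :
      SemiconjBy v (twist 1) (w * twist 1 * w⁻¹) ↔ Commute b (twist 1) := by
    subst hw
    have hv : v * b * twist 1 * (v * b)⁻¹ * v = v * (b * twist 1 * b⁻¹) := by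
      simp only [mul_inv_rev, mul_assoc, inv_mul_cancel, mul_one]
    rw [SemiconjBy, hv, mul_right_inj, eq_mul_inv_iff_mul_eq, commute_iff_eq, eq_comm]
  constructor
  · rintro ⟨⟨a, ha⟩, b⟩ ⟨⟨a', ha'⟩, b'⟩ (h : pairPerm _ _ * _ = pairPerm _ _ * _)
    obtain rfl : a = a' := (hmatch _).unique
      ⟨ha, (hsemi _ _ _ rfl).2 (commute_blockPerm_twist_one _ _)⟩
      ⟨ha', (hsemi _ _ _ h.symm).2 (commute_blockPerm_twist_one _ _)⟩
    obtain rfl : b = b' := blockPerm_injective (mul_left_cancel h)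
    rfl
  · intro w
    obtain ⟨a, ha, hw⟩ := (hmatch w).exists
    obtain ⟨π, e, he⟩ := exists_eq_blockPerm_of_commute
      ((hsemi w _ _ (mul_inv_cancel_left _ w)).1 hw)
    exact ⟨(⟨a, ha⟩, (π, e)), by simp only [← he, mul_inv_cancel_left]⟩

end matching

/-! ### Polarized Pfaffians -/

section mixedPfaffian

open scoped Matrix

lemma sum_eq_sum_perm {α M : Type*} [Fintype α] [DecidableEq α] [AddCommMonoid M]
    {F : (α → α) → M} (hF : ∀ g, ¬Function.Bijective g → F g = 0) :
    ∑ g, F g = ∑ π : Perm α, F π := by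
  symm
  refine Fintype.sum_of_injective _ DFunLike.coe_injective _ _ (fun g hg => hF g fun h => ?_)
    fun _ => rfl
  exact hg ⟨Equiv.ofBijective g h, rfl⟩

lemma sum_single_eq_iff_bijective {α : Type*} [Fintype α] {g : α → α} :
    (∑ m, Finsupp.single (g m) 1 : α →₀ ℕ) = ∑ m, Finsupp.single m 1 ↔
      Function.Bijective g := by
  classical
  refine ⟨fun h => Finite.surjective_iff_bijective.1 fun j => by_contra fun hj => ?_,
    fun h => h.sum_comp fun m => Finsupp.single m 1⟩
  push Not at hj
  simpa [Finsupp.single_apply, hj] using DFunLike.congr_fun h j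

variable {ι C : Type*} [Fintype ι] [DecidableEq ι] [CommRing C]

/-- The term of the permutation `w` in `mixedPfaffian`. -/
def pfaffianTerm (w : Perm (ι × Fin 2)) :
    MultilinearMap C (fun _ : ι => Matrix (ι × Fin 2) (ι × Fin 2) C) C :=
  (sign w : ℤ) • (MultilinearMap.mkPiAlgebra C ι C).compLinearMap fun m =>
    Matrix.entryLinearMap C C (w (m, 0)) (w (m, 1))

lemma pfaffianTerm_apply (w : Perm (ι × Fin 2)) (P : ι → Matrix (ι × Fin 2) (ι × Fin 2) C) :
    pfaffianTerm w P = (sign w : ℤ) • ∏ m, P m (w (m, 0)) (w (m, 1)) := rfl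

/-- The polarization of the Pfaffian, without division: for a skew-symmetric matrix `B` of size
`2n`, the value at `(B, …, B)` is `2 ^ n * n!` times the Pfaffian of `B`. -/
def mixedPfaffian : MultilinearMap C (fun _ : ι => Matrix (ι × Fin 2) (ι × Fin 2) C) C :=
  ∑ w, pfaffianTerm w

lemma mixedPfaffian_apply (P : ι → Matrix (ι × Fin 2) (ι × Fin 2) C) :
    mixedPfaffian P = ∑ w, pfaffianTerm w P := by
  simp [mixedPfaffian]

lemma pfaffianTerm_mul_twist (w : Perm (ι × Fin 2)) (e : ι → Fin 2)
    (P : ι → Matrix (ι × Fin 2) (ι × Fin 2) C) :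
    pfaffianTerm (w * twist e) P = pfaffianTerm w fun m => ![P m, -(P m)ᵀ] (e m) := by
  have h (m : ι) : ![P m, -(P m)ᵀ] (e m) (w (m, 0)) (w (m, 1)) =
      ((-1 : ℤ) ^ (e m : ℕ)) • P m (w (m, 0 + e m)) (w (m, 1 + e m)) := by
    obtain he | he := Fin.exists_fin_two.1 ⟨e m, rfl⟩ <;> simp [he]
  simp only [pfaffianTerm_apply, h, Perm.sign_mul, Units.val_mul, sign_twist, Perm.mul_apply,
    twist_apply, zsmul_eq_mul, prod_mul_distrib]
  push_cast
  ring

lemma pfaffianTerm_mul_prodCongrLeft (w : Perm (ι × Fin 2)) (π : Perm ι)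
    (P : ι → Matrix (ι × Fin 2) (ι × Fin 2) C) :
    pfaffianTerm (w * prodCongrLeft fun _ => π) (P ∘ π) = pfaffianTerm w P := by
  rw [pfaffianTerm_apply, Perm.sign_mul, sign_prodCongrLeft_const, mul_one,
    pfaffianTerm_apply, ← Equiv.prod_comp π fun m => P m (w (m, 0)) (w (m, 1))]
  rfl

lemma pfaffianTerm_mul_blockPerm {B : Matrix (ι × Fin 2) (ι × Fin 2) C} (hB : Bᵀ = -B)
    (w : Perm (ι × Fin 2)) (π : Perm ι) (e : ι → Fin 2) :
    pfaffianTerm (w * blockPerm π e) (fun _ => B) = pfaffianTerm w fun _ => B := by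
  have hconst (a : Fin 2) : ![B, B] a = B := by
    obtain rfl | rfl := Fin.exists_fin_two.1 ⟨a, rfl⟩ <;> rfl
  have h := pfaffianTerm_mul_prodCongrLeft (w * twist e) π fun _ => B
  rw [blockPerm, ← mul_assoc]
  refine h.trans ?_
  simp only [pfaffianTerm_mul_twist, hB, neg_neg, hconst]

lemma mixedPfaffian_comp_perm (P : ι → Matrix (ι × Fin 2) (ι × Fin 2) C) (π : Perm ι) :
    mixedPfaffian (P ∘ π) = mixedPfaffian P := by
  rw [mixedPfaffian_apply, mixedPfaffian_apply,
    ← Equiv.sum_comp (Equiv.mulRight (prodCongrLeft fun _ : Fin 2 => π))]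
  exact sum_congr rfl fun w _ => pfaffianTerm_mul_prodCongrLeft w π P

lemma mixedPfaffian_sub_transpose (P : ι → Matrix (ι × Fin 2) (ι × Fin 2) C) :
    mixedPfaffian (fun m => P m - (P m)ᵀ) = 2 ^ Fintype.card ι * mixedPfaffian P := by
  have hsum (m : ι) : P m - (P m)ᵀ = ∑ a, ![P m, -(P m)ᵀ] a := by simp [sub_eq_add_neg]
  have htwist (e : ι → Fin 2) :
      mixedPfaffian (fun m => ![P m, -(P m)ᵀ] (e m)) = mixedPfaffian P := by
    rw [mixedPfaffian_apply, mixedPfaffian_apply,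
      ← Equiv.sum_comp (Equiv.mulRight (twist e)) fun w => pfaffianTerm w P]
    exact sum_congr rfl fun w _ => (pfaffianTerm_mul_twist w e P).symm
  simp only [hsum, MultilinearMap.map_sum, htwist]
  simp

lemma map_mixedPfaffian {D : Type*} [CommRing D] (φ : C →+* D)
    (P : ι → Matrix (ι × Fin 2) (ι × Fin 2) C) :
    φ (mixedPfaffian P) = mixedPfaffian fun m => (P m).map φ := by
  simp [mixedPfaffian_apply, pfaffianTerm_apply]

lemma coeff_mixedPfaffian_sum_X_smul (P : ι → Matrix (ι × Fin 2) (ι × Fin 2) C) :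
    MvPolynomial.coeff (∑ m : ι, Finsupp.single m 1)
        (mixedPfaffian fun _ : ι => ∑ j, (MvPolynomial.X j : MvPolynomial ι C) •
          (P j).map MvPolynomial.C) =
      (Fintype.card ι).factorial * mixedPfaffian P := by
  have hterm (g : ι → ι) : mixedPfaffian (fun m => (MvPolynomial.X (g m) : MvPolynomial ι C) •
        (P (g m)).map MvPolynomial.C) =
      MvPolynomial.monomial (∑ m, Finsupp.single (g m) 1) (mixedPfaffian (P ∘ g)) := by
    have hX : ∏ m, (MvPolynomial.X (g m) : MvPolynomial ι C) =
        MvPolynomial.monomial (∑ m, Finsupp.single (g m) 1) 1 :=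
      (MvPolynomial.monomial_sum_one univ fun m => Finsupp.single (g m) 1).symm
    have hC : mixedPfaffian (fun m => (P (g m)).map (MvPolynomial.C (σ := ι))) =
        MvPolynomial.C (mixedPfaffian (P ∘ g)) :=
      (map_mixedPfaffian _ _).symm
    rw [MultilinearMap.map_smul_univ, hX, hC, smul_eq_mul, mul_comm,
      MvPolynomial.C_mul_monomial, mul_one]
  simp only [MultilinearMap.map_sum, hterm, MvPolynomial.coeff_sum, MvPolynomial.coeff_monomial]
  rw [sum_eq_sum_perm fun g hg => if_neg (mt sum_single_eq_iff_bijective.1 hg)]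
  simp only [sum_single_eq_iff_bijective.2 (Equiv.bijective _), mixedPfaffian_comp_perm]
  simp [Fintype.card_perm]

end mixedPfaffian

/-! ### The Moore determinant as a Pfaffian -/

section moore

open scoped Matrix

variable {R C : Type*} [CommRing R] [CommRing C] [Algebra R C] {I : C} (hI : I * I = -1)

/-- The `2 × 2` block matrix with blocks `φ (A l k) * J`, where `φ` is the complex representation
of the quaternions and `J` is the standard skew-symmetric matrix. It is skew-symmetric for
hyperhermitian `A`, and its Pfaffian is the Moore determinant of `A`. -/
def pfaffianMatrix {ι : Type*} (A : Matrix ι ι (Quaternion R)) :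
    Matrix (ι × Fin 2) (ι × Fin 2) C :=
  .of fun x y => (complexRep hI (A x.1 y.1) * !![0, 1; -1, 0] : Matrix (Fin 2) (Fin 2) C) x.2 y.2

lemma transpose_pfaffianMatrix {ι : Type*} {A : Matrix ι ι (Quaternion R)} (hA : A.IsHermitian) :
    (pfaffianMatrix hI A)ᵀ = -pfaffianMatrix hI A := by
  ext ⟨l, s⟩ ⟨k, t⟩
  have hstar : complexRep hI (A k l) = (complexRep hI (A l k)).adjugate := by
    rw [← hA.apply, complexRep_star]
  simp only [pfaffianMatrix, Matrix.transpose_apply, Matrix.of_apply, Matrix.neg_apply, hstar]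
  fin_cases s <;> fin_cases t <;> simp [Matrix.mul_apply, Matrix.adjugate_fin_two]

lemma pfaffianMatrix_apply_add_one {ι : Type*} (A : Matrix ι ι (Quaternion R)) (l k : ι)
    (s t : Fin 2) : pfaffianMatrix hI A (l, s) (k, t + 1) =
      (-1) ^ (t : ℕ) * complexRep hI (A l k) s t := by
  obtain rfl | rfl := Fin.exists_fin_two.1 ⟨t, rfl⟩ <;> simp [pfaffianMatrix, Matrix.mul_apply]

lemma pfaffianTerm_pairPerm {ι : Type*} [Fintype ι] [DecidableEq ι]
    (A : Matrix ι ι (Quaternion R)) (σ : Perm ι) (s : ι → Fin 2) :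
    pfaffianTerm (pairPerm σ s) (fun _ => pfaffianMatrix hI A) =
      (sign σ : ℤ) • ∏ l, complexRep hI (A l (σ l)) (s l) (s (σ l)) := by
  have hsq : (∏ l, (-1 : C) ^ (s l : ℕ)) * ∏ l, (-1 : C) ^ (s l : ℕ) = 1 := by
    simp [← prod_mul_distrib, ← mul_pow]
  simp only [pfaffianTerm_apply, pairPerm_zero, pairPerm_one, twist_apply, Pi.one_apply,
    pfaffianMatrix_apply_add_one, prod_mul_distrib, Equiv.prod_comp σ fun l => (-1 : C) ^ (s l : ℕ),
    sign_pairPerm, zsmul_eq_mul]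
  push_cast
  linear_combination
    (sign σ : ℤ) * (∏ l, complexRep hI (A l (σ l)) (s l) (s (σ l))) * hsq

theorem mixedPfaffian_pfaffianMatrix [IsAddTorsionFree R] [IsAddTorsionFree C] {n : ℕ}
    {A : Matrix (Fin n) (Fin n) (Quaternion R)} (hA : A.IsHermitian) :
    mixedPfaffian (fun _ => pfaffianMatrix hI A) =
      2 ^ n * (n.factorial * algebraMap R C (mooreDet A)) := by
  rw [mixedPfaffian_apply, ← (bijective_pairPerm_mul_blockPerm n).sum_comp, Fintype.sum_prod_type]
  simp only [pfaffianTerm_mul_blockPerm (transpose_pfaffianMatrix hI hA), pfaffianTerm_pairPerm,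
    sum_const, card_univ, Fintype.card_prod, Fintype.card_perm, Fintype.card_fun,
    Fintype.card_fin, ← smul_sum]
  rw [algebraMap_mooreDet_eq_sum hI hA, ← Fintype.sum_prod_type', ← sum_filter,
    ← Finset.sum_subtype_eq_sum_filter, subtype_univ, nsmul_eq_mul]
  push_cast
  ring

end moore

/-! ### Mixed discriminants -/

section mixedDiscriminant

lemma pfaffianMatrix_sum_smul {R C ι κ : Type*} [CommRing R] [CommRing C] [Algebra R C]
    [Fintype κ] {I : C} (hI : I * I = -1) (r : κ → R) (A : κ → Matrix ι ι (Quaternion R)) :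
    pfaffianMatrix hI (∑ m, r m • A m) = ∑ m, algebraMap R C (r m) • pfaffianMatrix hI (A m) := by
  ext x y
  simp [pfaffianMatrix, Matrix.sum_apply, sum_mul]

variable {n : ℕ}

lemma star_constPoly (x : Quaternion ℝ) : star (constPoly (n := n) x) = constPoly (star x) := by
  apply Quaternion.ext <;> simp only [Quaternion.re_star, Quaternion.imI_star,
    Quaternion.imJ_star, Quaternion.imK_star] <;> simp [constPoly]

lemma isHermitian_smul_map_constPoly {ι : Type*} (r : MvPolynomial (Fin n) ℝ)
    {A : Matrix ι ι (Quaternion ℝ)} (hA : A.IsHermitian) :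
    (r • A.map (constPoly (n := n))).IsHermitian :=
  Matrix.IsHermitian.ext fun l k => by
    rw [Matrix.smul_apply, Matrix.smul_apply, Matrix.map_apply, Matrix.map_apply,
      Quaternion.star_smul, star_constPoly, hA.apply]

lemma C_I_mul_C_I {σ : Type*} :
    (MvPolynomial.C Complex.I : MvPolynomial σ ℂ) * MvPolynomial.C Complex.I = -1 := by
  rw [← map_mul, Complex.I_mul_I, map_neg, map_one]

attribute [local instance] MvPolynomial.algebraMvPolynomial

lemma complexRep_constPoly (x : Quaternion ℝ) :
    complexRep C_I_mul_C_I (constPoly (n := n) x) =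
      (complexRep Complex.I_mul_I x).map (MvPolynomial.C (σ := Fin n)) := by
  rw [complexRep_apply, complexRep_apply]
  ext1 s t
  fin_cases s <;> fin_cases t <;> simp [constPoly]

lemma pfaffianMatrix_map_constPoly {ι : Type*} (A : Matrix ι ι (Quaternion ℝ)) :
    pfaffianMatrix (C_I_mul_C_I (σ := Fin n)) (A.map (constPoly (n := n))) =
      (pfaffianMatrix Complex.I_mul_I A).map MvPolynomial.C := by
  ext1 ⟨l, s⟩ ⟨k, t⟩
  fin_cases s <;> fin_cases t <;>
    simp [pfaffianMatrix, complexRep_constPoly, Matrix.mul_apply]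

theorem mixedPfaffian_pfaffianMatrix_eq_mixedDiscriminant
    {A : Fin n → Matrix (Fin n) (Fin n) (Quaternion ℝ)} (hA : ∀ m, (A m).IsHermitian) :
    mixedPfaffian (fun m => pfaffianMatrix Complex.I_mul_I (A m)) =
      2 ^ n * (n.factorial * (mixedDiscriminant A : ℂ)) := by
  let B : Matrix (Fin n) (Fin n) (Quaternion (MvPolynomial (Fin n) ℝ)) :=
    ∑ m, (MvPolynomial.X m : MvPolynomial (Fin n) ℝ) • (A m).map (constPoly (n := n))
  have hB : B.IsHermitian :=
    sum_induction _ Matrix.IsHermitian (fun _ _ => .add) Matrix.isHermitian_zero fun m _ =>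
      isHermitian_smul_map_constPoly _ (hA m)
  have hpfaffian : pfaffianMatrix (C_I_mul_C_I (σ := Fin n)) B =
      ∑ m, (MvPolynomial.X m : MvPolynomial (Fin n) ℂ) •
        (pfaffianMatrix Complex.I_mul_I (A m)).map MvPolynomial.C := by
    simp only [B, pfaffianMatrix_sum_smul, pfaffianMatrix_map_constPoly,
      MvPolynomial.algebraMap_def, MvPolynomial.map_X]
  have hn : (n.factorial : ℂ) ≠ 0 := by exact_mod_cast n.factorial_ne_zero
  have hdet : (MvPolynomial.coeff (∑ m : Fin n, Finsupp.single m 1) (mooreDet B) : ℝ) =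
      n.factorial * (mixedDiscriminant A : ℂ) := by
    rw [mixedDiscriminant, Complex.ofReal_div, Complex.ofReal_natCast, mul_div_cancel₀ _ hn]
    rfl
  refine mul_left_cancel₀ hn ?_
  calc (n.factorial : ℂ) * mixedPfaffian (fun m => pfaffianMatrix Complex.I_mul_I (A m))
    _ = MvPolynomial.coeff (∑ m : Fin n, Finsupp.single m 1)
        (mixedPfaffian fun _ : Fin n => pfaffianMatrix (C_I_mul_C_I (σ := Fin n)) B) := by
      rw [hpfaffian, coeff_mixedPfaffian_sum_X_smul, Fintype.card_fin]
    _ = MvPolynomial.coeff (∑ m : Fin n, Finsupp.single m 1)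
        (MvPolynomial.C (2 ^ n * n.factorial : ℂ) *
          MvPolynomial.map (algebraMap ℝ ℂ) (mooreDet B)) := by
      rw [mixedPfaffian_pfaffianMatrix _ hB, ← mul_assoc]
      simp only [map_mul, map_pow, map_ofNat, map_natCast, MvPolynomial.algebraMap_def]
    _ = n.factorial * (2 ^ n * (n.factorial * (mixedDiscriminant A : ℂ))) := by
      rw [MvPolynomial.coeff_C_mul, MvPolynomial.coeff_map, Complex.coe_algebraMap, hdet]
      ring

end mixedDiscriminant

/-! ### Second-order operators on `ℍⁿ` -/

section analysis

open scoped Matrix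

variable {n : ℕ} {u : (Fin n → Quaternion ℝ) → ℝ}

lemma differentiable_partialX (hu : ContDiff ℝ 2 u) (l : Fin n) (a : Fin 4) :
    Differentiable ℝ (partialX l a u) :=
  ((hu.fderiv_right le_rfl).differentiable one_ne_zero).clm_apply (differentiable_const _)

lemma partialX_partialX_comm (hu : ContDiff ℝ 2 u) (l k : Fin n) (a b : Fin 4)
    (q : Fin n → Quaternion ℝ) :
    partialX l a (partialX k b u) q = partialX k b (partialX l a u) q := by
  have hd : DifferentiableAt ℝ (fderiv ℝ u) q :=
    ((hu.fderiv_right le_rfl).differentiable one_ne_zero) q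
  have h (v w : Fin n → Quaternion ℝ) :
      fderiv ℝ (fun p => fderiv ℝ u p v) q w = fderiv ℝ (fderiv ℝ u) q w v := by
    simp [fderiv_clm_apply hd (differentiableAt_const v)]
  have hsymm : IsSymmSndFDerivAt ℝ u q := hu.contDiffAt.isSymmSndFDerivAt (by simp)
  exact (h _ _).trans ((hsymm _ _).trans (h _ _).symm)

section algebra

variable {E : Type*} [NormedRing E] [NormedAlgebra ℝ E]

lemma partialX_algebraMap {g : (Fin n → Quaternion ℝ) → ℝ} (hg : Differentiable ℝ g) (l : Fin n)
    (a : Fin 4) (q : Fin n → Quaternion ℝ) :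
    partialX l a (fun p => algebraMap ℝ E (g p)) q = algebraMap ℝ E (partialX l a g q) := by
  simp only [partialX, Algebra.algebraMap_eq_smul_one, fderiv_smul_const (hg q)]
  rfl

lemma partialX_sum_mul {κ : Type*} [Fintype κ] {g : κ → (Fin n → Quaternion ℝ) → E}
    (hg : ∀ b, Differentiable ℝ (g b)) (l : Fin n) (a : Fin 4) (d : κ → E)
    (q : Fin n → Quaternion ℝ) :
    partialX l a (fun p => ∑ b, d b * g b p) q = ∑ b, d b * partialX l a (g b) q := by
  rw [partialX, fderiv_fun_sum fun b _ => ((hg b) q).const_mul (d b), _root_.sum_apply]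
  exact sum_congr rfl fun b _ => by rw [fderiv_const_mul ((hg b) q)]; rfl

lemma sum_mul_partialX_sum_mul_partialX (hu : ContDiff ℝ 2 u) (l k : Fin n) (c d : Fin 4 → E)
    (q : Fin n → Quaternion ℝ) :
    ∑ a, c a * partialX l a
        (fun p => ∑ b, d b * partialX k b (fun p => algebraMap ℝ E (u p)) p) q =
      ∑ a, ∑ b, partialX l a (partialX k b u) q • (c a * d b) := by
  have hdiff (b : Fin 4) : Differentiable ℝ fun p => algebraMap ℝ E (partialX k b u p) :=
    (Algebra.linearMap ℝ E).toContinuousLinearMap.differentiable.comp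
      (differentiable_partialX hu k b)
  simp only [partialX_algebraMap (hu.differentiable two_ne_zero), partialX_sum_mul hdiff,
    partialX_algebraMap (differentiable_partialX hu k _), mul_sum]
  refine sum_congr rfl fun a _ => sum_congr rfl fun b _ => ?_
  rw [← mul_assoc, ← Algebra.commutes, Algebra.smul_def]

end algebra

lemma hessian_apply (hu : ContDiff ℝ 2 u) (l k : Fin n) (q : Fin n → Quaternion ℝ) :
    hessian u q l k =
      ∑ a, ∑ b, partialX l a (partialX k b u) q • (unit a * star (unit b)) :=
  sum_mul_partialX_sum_mul_partialX hu l k unit (fun b => star (unit b)) q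

lemma isHermitian_hessian (hu : ContDiff ℝ 2 u) (q : Fin n → Quaternion ℝ) :
    (hessian u q).IsHermitian := by
  refine Matrix.IsHermitian.ext fun l k => ?_
  rw [hessian_apply hu, hessian_apply hu, sum_comm]
  simp only [star_sum, Quaternion.star_smul, star_mul, star_star, partialX_partialX_comm hu k l]

lemma nabla_eq_sum (l : Fin n) (s α : Fin 2) (F : (Fin n → Quaternion ℝ) → ℂ)
    (q : Fin n → Quaternion ℝ) :
    nabla (l, s) α F q = ∑ a, complexRep Complex.I_mul_I (unit a) s α * partialX l a F q := by
  fin_cases s <;> fin_cases α <;>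
    simp [nabla, Fin.sum_univ_four, complexRep_apply, unit, sub_eq_add_neg]

lemma nabla_nabla_apply (hu : ContDiff ℝ 2 u) (l k : Fin n) (s t α β : Fin 2)
    (q : Fin n → Quaternion ℝ) :
    nabla (l, s) α (nabla (k, t) β fun p => (u p : ℂ)) q =
      ∑ a, ∑ b, partialX l a (partialX k b u) q •
        (complexRep Complex.I_mul_I (unit a) s α * complexRep Complex.I_mul_I (unit b) t β) := by
  rw [nabla_eq_sum, funext (nabla_eq_sum k t β _)]
  exact sum_mul_partialX_sum_mul_partialX hu l k (fun a => complexRep Complex.I_mul_I (unit a) s α)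
    (fun b => complexRep Complex.I_mul_I (unit b) t β) q

lemma two_smul_triangle (hu : ContDiff ℝ 2 u) (q : Fin n → Quaternion ℝ) :
    (2 : ℂ) • Matrix.of (fun i j => triangle i j u q) =
      Matrix.of (fun i j => nabla2 i j u q) - (Matrix.of fun i j => nabla2 i j u q)ᵀ := by
  ext ⟨l, s⟩ ⟨k, t⟩
  have hcomm : nabla (l, s) 1 (nabla (k, t) 0 fun p => (u p : ℂ)) q =
      nabla (k, t) 0 (nabla (l, s) 1 fun p => (u p : ℂ)) q := by
    rw [nabla_nabla_apply hu, nabla_nabla_apply hu, sum_comm]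
    simp only [partialX_partialX_comm hu l k, mul_comm]
  simp [triangle, nabla2, hcomm, mul_div_cancel₀]

lemma pfaffianMatrix_hessian (hu : ContDiff ℝ 2 u) (q : Fin n → Quaternion ℝ) :
    pfaffianMatrix Complex.I_mul_I (hessian u q) =
      (2 : ℂ) • Matrix.of (fun i j => triangle i j u q) := by
  ext ⟨l, s⟩ ⟨k, t⟩
  simp only [pfaffianMatrix, Matrix.of_apply, Matrix.smul_apply, triangle, smul_eq_mul,
    mul_div_cancel₀ _ (two_ne_zero' ℂ), nabla_nabla_apply hu, hessian_apply hu, map_sum,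
    map_smul, sum_mul, Matrix.sum_apply, ← sum_sub_distrib, ← smul_sub, map_mul, complexRep_star,
    Matrix.smul_mul]
  refine sum_congr rfl fun a _ => sum_congr rfl fun b _ => ?_
  congr 1
  fin_cases t <;> simp [Matrix.mul_apply, Matrix.adjugate_fin_two] <;> ring

end analysis

/-! ### Baston's operators as mixed Pfaffians -/

section baston

variable {n : ℕ}

lemma sum_delta_mul (P : Fin n → Matrix (Fin n × Fin 2) (Fin n × Fin 2) ℂ) :
    ∑ w : Fin n × Fin 2 → Fin n × Fin 2, delta w * ∏ m, P m (w (m, 0)) (w (m, 1)) =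
      mixedPfaffian P := by
  rw [sum_eq_sum_perm fun w hw => by rw [delta, dif_neg hw, zero_mul], mixedPfaffian_apply]
  refine sum_congr rfl fun π _ => ?_
  rw [delta, dif_pos π.bijective, pfaffianTerm_apply, zsmul_eq_mul,
    show Equiv.ofBijective π π.bijective = π from Equiv.ext fun _ => rfl]

lemma two_pow_mul_bastonMixed {f : Fin n → (Fin n → Quaternion ℝ) → ℝ}
    (hf : ∀ m, ContDiff ℝ 2 (f m)) (q : Fin n → Quaternion ℝ) :
    2 ^ n * bastonMixed f q =
      mixedPfaffian fun m => pfaffianMatrix Complex.I_mul_I (hessian (f m) q) := by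
  simp only [pfaffianMatrix_hessian (hf _)]
  rw [MultilinearMap.map_smul_univ, ← sum_delta_mul]
  simp [bastonMixed]

lemma bastonMixed_const {u : (Fin n → Quaternion ℝ) → ℝ} (hu : ContDiff ℝ 2 u)
    (q : Fin n → Quaternion ℝ) : bastonMixed (fun _ => u) q = baston u q := by
  refine mul_left_cancel₀ (pow_ne_zero n (two_ne_zero' ℂ)) ?_
  rw [two_pow_mul_bastonMixed fun _ => hu, pfaffianMatrix_hessian hu, two_smul_triangle hu,
    mixedPfaffian_sub_transpose, ← sum_delta_mul, Fintype.card_fin]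
  rfl

end baston

end

end QuatMA

theorem theoremA1 (n : ℕ) :
    (∀ f : Fin n → (Fin n → Quaternion ℝ) → ℝ, (∀ i, ContDiff ℝ 2 (f i)) →
      ∀ q : Fin n → Quaternion ℝ,
        QuatMA.bastonMixed f q =
          (((n.factorial : ℝ) *
            QuatMA.mixedDiscriminant (fun i => QuatMA.hessian (f i) q) : ℝ) : ℂ)) ∧
    (∀ u : (Fin n → Quaternion ℝ) → ℝ, ContDiff ℝ 2 u →
      ∀ q : Fin n → Quaternion ℝ,
        QuatMA.bastonMixed (fun _ => u) q = QuatMA.baston u q ∧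
        QuatMA.baston u q =
          (((n.factorial : ℝ) * QuatMA.mooreDet (QuatMA.hessian u q) : ℝ) : ℂ)) := by
  have htwo : (2 ^ n : ℂ) ≠ 0 := pow_ne_zero n two_ne_zero
  refine ⟨fun f hf q => mul_left_cancel₀ htwo ?_, fun u hu q => ⟨QuatMA.bastonMixed_const hu q,
    mul_left_cancel₀ htwo ?_⟩⟩
  · rw [QuatMA.two_pow_mul_bastonMixed hf,
      QuatMA.mixedPfaffian_pfaffianMatrix_eq_mixedDiscriminant fun m =>
        QuatMA.isHermitian_hessian (hf m) q]
    push_cast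
    rfl
  · rw [← QuatMA.bastonMixed_const hu, QuatMA.two_pow_mul_bastonMixed fun _ => hu,
      QuatMA.mixedPfaffian_pfaffianMatrix _ (QuatMA.isHermitian_hessian hu q)]
    push_cast
    rfl
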